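/- **Model (synchronous idealized DAG protocol).** There are $n$ validators; a set of $h$ of them is honest, with honest fraction $H=h/n\in(1/2,1]$. Slots are $1,2,\dots$. In each slot each validator is eligible with probability $p\in(0,1]$, independently over slots and validators, and a validator can create at most one block per slot, only when eligible. The genesis block has slot $0$. Every block references older blocks (of strictly smaller slot); $a$ is an ancestor of $b$ if $b$ reaches $a$ along references. All honest parties have the same view at the end of each slot (initially only genesis; views only grow; with a block they contain all blocks it references; they contain no blocks of future slots). For a window length $w\ge 1$, a reference is short if it spans at most $w$ slots, and the tips at the end of slot $t$ are the visible blocks of slot $\ge t-w$ that no visible block of slot $\ge t-w$ short-references. An eligible honest validator creates a block that references all tips visible at the start of the slot (and possibly further visible blocks), and it is delivered to all honest parties by the end of the slot. Corrupted validators may behave arbitrarily otherwise: they choose whether to create a block, its references and when to reveal it, depending on all coins. Payloads never conflict. The preferred frontier $F_t$ consists of the tips that are not beaten by a conflicting tip in the fork-choice rule (hence of all tips, as there are no conflicts); $\mathrm{Past}_P(t)$ is the set of blocks that are in party $P$'s frontier $F_t$ or are ancestors of blocks in it; $\mathrm{Trim}(\mathrm{Past}_P(t),k)$ is the set of its blocks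 of slot $\le t-k$. The parameters $n,h,p,w$, and the lengths $\ell,T$ below, may depend on the security parameter $\kappa$. Let $\lambda_h=pHn$ be the expected number of honest blocks per slot. "With overwhelming probability" means: except with probability at most $\varepsilon(\kappa)$ for a negligible $\varepsilon$ that does not depend on the adversary or on the starting slot $t$. **Theorem.** 1. (DAG growth) There is $\tau_D=\tau_D(p,H)\in(0,1]$ with $\tau_D=\Theta(pH)$ (absolute constants) such that, whenever $w\lambda_h=\omega(\log\kappa)$, $\ell\lambda_h=\omega(\log\kappa)$ and $\ell$ is polynomially bounded, for every slot $t\ge1$, with overwhelming probability at least $\tau_D\,\ell$ honest blocks created in the slots $t,\dots,t+\ell-1$ lie in $\mathrm{Past}_P(t+\ell-1)$ for some honest $P$. 2. (DAG quality) For every constant $C$ there is $\mu_D=\mu_D(H)\in(0,1]$ with $\mu_D=\Theta(H)$ (constants depending only on $C$) such that, whenever $\ell\lambda_h=\omega(\log\kappa)$ and $w\le C\ell$ for all large $\kappa$, for every slot $t\ge1$, with overwhelming probability, for every honest party, at least a fraction $\mu_D$ of the blocks that enter its preferred frontier during the slots $t,\dots,t+\ell-1$ (that is, lie in $F_s\setminus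 F_{s-1}$ for such a slot $s$) was created by honest validators. 3. (DAG common past) There is an absolute constant $k_D$ such that, whenever $\lambda_h=\omega(\log\kappa)$ and $T$ is polynomially bounded, for every $t$, with overwhelming probability $$\mathrm{Trim}(\mathrm{Past}_P(t_1),k_D)\subseteq \mathrm{Trim}(\mathrm{Past}_Q(t_2),k_D)$$ for all honest parties $P,Q$ and all times $t\le t_1\le t_2\le t+T$. -/

import Mathlib

open Filter MeasureTheory ProbabilityTheory Asymptotics

universe u

namespace AreonIdeal

/-! ### Blocks and executions -/

/-- Blocks of an execution with `n` validators. In the idealized protocol a validator produces at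
most one block per slot, so a non-genesis block is identified by its slot and its validator. -/
inductive Block (n : ℕ) : Type
  | genesis : Block n
  | mk (slot : ℕ) (validator : Fin n) : Block n

/-- The slot of a block; genesis has slot `0`, all other blocks have slots `≥ 1` (see
`Execution.Valid`). -/
def Block.slot {n : ℕ} : Block n → ℕ
  | .genesis => 0
  | .mk s _ => s

/-- `b` was created by a validator of `honest`. -/
def Block.IsHonest {n : ℕ} (honest : Finset (Fin n)) : Block n → Prop
  | .genesis => False
  | .mk _ v => v ∈ honest

/-- The data of one execution: the references of the blocks, the public-coin labels used for
tie-breaking, the application-level conflict relation of payloads, and the view `view P t` of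
party `P` at the end of slot `t`. -/
structure Execution (n : ℕ) where
  refs : Block n → Finset (Block n)
  label : Block n → ℕ
  conflicts : Block n → Block n → Prop
  view : Fin n → ℕ → Finset (Block n)

namespace Execution

variable {n : ℕ} (E : Execution n)

/-! ### Ancestry -/

/-- The edge `a → b` (that is, `b` references `a`) of the subgraph induced on the view `V`. -/
def Edge (V : Finset (Block n)) (a b : Block n) : Prop :=
  a ∈ V ∧ b ∈ V ∧ a ∈ E.refs b

/-- `a` is an ancestor of `b` in the view `V`. -/
def IsAnc (V : Finset (Block n)) (a b : Block n) : Prop :=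
  Relation.TransGen (E.Edge V) a b

/-- `a` is an ancestor of `b` in the view `V`, or `a = b`. -/
def IsAncStar (V : Finset (Block n)) (a b : Block n) : Prop :=
  Relation.ReflTransGen (E.Edge V) a b

/-! ### Short references and tips -/

/-- The short references of a block: those to blocks at most `w` slots older. -/
def shortRefs (w : ℕ) (d : Block n) : Finset (Block n) :=
  (E.refs d).filter fun r => r.slot + 1 ≤ d.slot ∧ d.slot ≤ r.slot + w

/-- The window `V_w(t)` of the view of `P` at the end of slot `t`: the blocks of slot `≥ t - w`. -/
def window (w : ℕ) (P : Fin n) (t : ℕ) : Set (Block n) :=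
  {b | b ∈ E.view P t ∧ t ≤ b.slot + w}

/-- The short-reference tips of the view of `P` at the end of slot `t`: the blocks of the window
that no block of the window short-references. -/
def tips (w : ℕ) (P : Fin n) (t : ℕ) : Set (Block n) :=
  {b | b ∈ E.window w P t ∧ ¬ ∃ d ∈ E.window w P t, b ∈ E.shortRefs w d}

/-! ### Fork choice -/

/-- `c` is a closest common ancestor of `i` and `j`: a common ancestor that maximizes
`(slot, label)` lexicographically. -/
def IsCCA (V : Finset (Block n)) (i j c : Block n) : Prop :=
  (E.IsAnc V c i ∧ E.IsAnc V c j) ∧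
    ∀ c', E.IsAnc V c' i → E.IsAnc V c' j →
      toLex (c'.slot, E.label c') ≤ toLex (c.slot, E.label c)

open Classical in
/-- The subDAG weight of `i` relative to `c`: the number of short references made by the common
descendants of `i` and `c` (both included). -/
noncomputable def subdagWeight (w : ℕ) (V : Finset (Block n)) (i c : Block n) : ℕ :=
  ∑ d ∈ V.filter (fun d => E.IsAncStar V i d ∧ E.IsAncStar V c d), (E.shortRefs w d).card

/-- Conflicted-tips resolution selects `x` against `x'`: larger subDAG weight relative to the
closest common ancestor, ties broken by the larger label. -/
def Beats (w : ℕ) (V : Finset (Block n)) (x x' : Block n) : Prop :=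
  ∃ c, E.IsCCA V x x' c ∧
    (E.subdagWeight w V x' c < E.subdagWeight w V x c ∨
      (E.subdagWeight w V x' c = E.subdagWeight w V x c ∧ E.label x' < E.label x))

/-- The preferred frontier `F_t` of `P`: the tips that are not beaten by a conflicting tip. -/
def frontier (w : ℕ) (P : Fin n) (t : ℕ) : Set (Block n) :=
  {x | x ∈ E.tips w P t ∧
    ¬ ∃ x' ∈ E.tips w P t, E.conflicts x' x ∧ E.Beats w (E.view P t) x' x}

/-- `Past_P(t)`: the preferred frontier of `P` at the end of slot `t` and all its ancestors. -/
def past (w : ℕ) (P : Fin n) (t : ℕ) : Set (Block n) :=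
  {b | ∃ x ∈ E.frontier w P t, E.IsAncStar (E.view P t) b x}

/-- `Trim(Past_P(t), k)`: the past without the blocks of the `k` most recent slots
`t - k + 1, …, t`. -/
def trimmedPast (w k : ℕ) (P : Fin n) (t : ℕ) : Set (Block n) :=
  {b | b ∈ E.past w P t ∧ b.slot + k ≤ t}

/-! ### The synchronous idealized protocol -/

/-- `E` is an execution of the synchronous idealized protocol with window `w`, honest validators
`honest` and eligibility outcomes `elig (s, v)`. Nothing beyond these rules constrains the
corrupted validators: when eligible they may or may not create a block, with any references to
older blocks, and may reveal it in any later slot. -/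
structure Valid (w : ℕ) (honest : Finset (Fin n)) (elig : ℕ × Fin n → Bool) : Prop where
  /-- There are no conflicts between payloads. -/
  noConflict : ∀ b b', ¬ E.conflicts b b'
  /-- Everybody starts from genesis. -/
  view_zero : ∀ P ∈ honest, E.view P 0 = {Block.genesis}
  /-- Views only grow. -/
  view_mono : ∀ P ∈ honest, ∀ t, E.view P t ⊆ E.view P (t + 1)
  /-- Synchrony (honest parties relay what they accept): a block in an honest view at the end of
  slot `t` is in every honest view at the end of slot `t`. -/
  sync : ∀ P ∈ honest, ∀ Q ∈ honest, ∀ t, E.view P t ⊆ E.view Q t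
  /-- Only blocks of eligible validators, of the present or an earlier slot, are accepted. -/
  eligible : ∀ P ∈ honest, ∀ t s v, Block.mk s v ∈ E.view P t →
    1 ≤ s ∧ s ≤ t ∧ elig (s, v) = true
  /-- References of accepted blocks are known and point strictly backward in slot. -/
  refs_valid : ∀ P ∈ honest, ∀ t, ∀ b ∈ E.view P t, ∀ r ∈ E.refs b,
    r ∈ E.view P t ∧ r.slot < b.slot
  /-- An eligible honest validator creates a block and broadcasts it in the same slot. -/
  honest_creates : ∀ v ∈ honest, ∀ s, elig (s + 1, v) = true →
    Block.mk (s + 1) v ∈ E.view v (s + 1)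
  /-- Unbounded referencing: an honest block may reference any blocks visible at the start of the
  slot, and it references all tips that are visible then. -/
  honest_refs : ∀ v ∈ honest, ∀ s, elig (s + 1, v) = true →
    E.tips w v s ⊆ ↑(E.refs (Block.mk (s + 1) v)) ∧
      E.refs (Block.mk (s + 1) v) ⊆ E.view v s

/-! ### The sets that growth and quality count -/

/-- The honest blocks created in the slots `t, …, t + ℓ - 1` that at the end of slot `t + ℓ - 1`
lie in the past of the preferred frontier of some honest party. -/
def grown (w : ℕ) (honest : Finset (Fin n)) (t ℓ : ℕ) : Set (Block n) :=
  {b | b.IsHonest honest ∧ t ≤ b.slot ∧ b.slot < t + ℓ ∧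
    ∃ P ∈ honest, b ∈ E.past w P (t + ℓ - 1)}

/-- The blocks that enter the preferred frontier of `P` during the slots `t, …, t + ℓ - 1`
(for `t ≥ 1`). -/
def entering (w : ℕ) (P : Fin n) (t ℓ : ℕ) : Set (Block n) :=
  {b | ∃ s, t ≤ s ∧ s < t + ℓ ∧ b ∈ E.frontier w P s ∧ b ∉ E.frontier w P (s - 1)}

end Execution

/-! ### Parameters, probability and the consensus properties -/

/-- Parameters of the idealized protocol. -/
structure Params where
  /-- number of validators -/
  n : ℕ
  /-- the honest validators -/
  honest : Finset (Fin n)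
  /-- probability that a given validator is eligible in a given slot -/
  p : ℝ
  /-- length of the short-reference window -/
  w : ℕ
  p_pos : 0 < p
  p_le_one : p ≤ 1
  w_pos : 1 ≤ w
  honest_majority : (1 : ℝ) / 2 < (honest.card : ℝ) / n

/-- The honest fraction `H` of the validators. -/
noncomputable def Params.H (par : Params) : ℝ := (par.honest.card : ℝ) / par.n

/-- The expected number `p H n` of honest blocks per slot. -/
noncomputable def Params.honestRate (par : Params) : ℝ := par.p * par.honest.card

/-- Public-coin eligibility: independent coins for all slots and validators, each of which is
`true` with probability `p`. -/
structure PublicCoin {Ω : Type u} [MeasurableSpace Ω] (Pr : Measure Ω) {n : ℕ} (p : ℝ)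
    (coin : ℕ × Fin n → Ω → Bool) : Prop where
  measurable : ∀ i, Measurable (coin i)
  indep : iIndepFun coin Pr
  prob : ∀ i, Pr {ω | coin i ω = true} = ENNReal.ofReal p

/-- `f = ω(log κ)`. -/
def SuperLog (f : ℕ → ℝ) : Prop :=
  (fun κ : ℕ => Real.log κ) =o[atTop] f

/-- `f` is polynomially bounded. -/
def PolyBounded (f : ℕ → ℕ) : Prop :=
  ∃ d : ℕ, (fun κ : ℕ => (f κ : ℝ)) =O[atTop] fun κ : ℕ => (κ : ℝ) ^ d

/-- Negligible functions of the security parameter. -/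
def Negligible (ε : ℕ → ℝ) : Prop :=
  SuperpolynomialDecay atTop (fun κ : ℕ => (κ : ℝ)) ε

/-- The property `good κ t`, about the execution from slot `t` on, fails with probability at most
`ε κ` for a negligible function `ε` that depends neither on `t` nor on the adversary. The execution
`E ω` may depend on the sample point in any way that respects the protocol, so that the corrupted
validators may be randomized and may adapt to all coins. No measurability of `E` is required; the
(outer) measure of the event of failure is bounded. -/
def WithOverwhelmingProb (par : ℕ → Params)
    (good : (κ : ℕ) → ℕ → Execution (par κ).n → Prop) : Prop :=
  ∃ ε : ℕ → ℝ, Negligible ε ∧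
    ∀ (κ t : ℕ) (Ω : Type u) [MeasurableSpace Ω] (Pr : Measure Ω) [IsProbabilityMeasure Pr]
      (coin : ℕ × Fin (par κ).n → Ω → Bool) (E : Ω → Execution (par κ).n),
      PublicCoin Pr (par κ).p coin →
      (∀ ω, (E ω).Valid (par κ).w (par κ).honest (fun i => coin i ω)) →
      Pr {ω | ¬ good κ t (E ω)} ≤ ENNReal.ofReal (ε κ)

/-- DAG growth `DG[τ, ℓ]`: in every interval of `ℓ` slots, at least `τ ℓ` honest blocks are created
and lie in the past of an honest preferred frontier by the end of the interval. -/
def DAGGrowth (par : ℕ → Params) (τ : ℕ → ℝ) (ℓ : ℕ → ℕ) : Prop :=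
  WithOverwhelmingProb.{u} par fun κ t E =>
    1 ≤ t → τ κ * ℓ κ ≤ ((E.grown (par κ).w (par κ).honest t (ℓ κ)).ncard : ℝ)

/-- DAG quality `DQ[μ, ℓ]`: in every interval of `ℓ` slots and for every honest party, at least a
fraction `μ` of the blocks that enter the preferred frontier is honest. -/
def DAGQuality (par : ℕ → Params) (μ : ℕ → ℝ) (ℓ : ℕ → ℕ) : Prop :=
  WithOverwhelmingProb.{u} par fun κ t E =>
    1 ≤ t → ∀ P ∈ (par κ).honest,
      μ κ * ((E.entering (par κ).w P t (ℓ κ)).ncard : ℝ) ≤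
        (({b ∈ E.entering (par κ).w P t (ℓ κ) | b.IsHonest (par κ).honest}).ncard : ℝ)

/-- DAG common past with parameter `k` over stretches of `T` slots: for all honest `P`, `Q` and all
times `t₁ ≤ t₂` of the stretch, the trimmed past of `P` at time `t₁` is contained in that of `Q` at
time `t₂`. -/
def DAGCommonPast (par : ℕ → Params) (k : ℕ) (T : ℕ → ℕ) : Prop :=
  WithOverwhelmingProb.{u} par fun κ t E =>
    ∀ P ∈ (par κ).honest, ∀ Q ∈ (par κ).honest, ∀ t₁ t₂ : ℕ,
      t ≤ t₁ → t₁ ≤ t₂ → t₂ ≤ t + T κ →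
        E.trimmedPast (par κ).w k P t₁ ⊆ E.trimmedPast (par κ).w k Q t₂

end AreonIdeal

/-! ### Deterministic consequences of the protocol rules -/

namespace AreonIdeal

namespace Execution

variable {n : ℕ} {E : Execution n}

/-! Without conflicts the frontier is the set of all tips, and every window block reaches a tip
through short references. An honest block references all tips of the previous slot, so it has the
whole past among its ancestors and preserves it as long as it stays in the window
(`past_subset_past`). An honest block in each stretch of `w` slots therefore keeps honest blocks in
the past (`mem_past_of_dense`), and one in every slot makes the past monotone
(`trimmedPast_subset`).

For quality, honest blocks enter the frontier in their own slot, while every entering block other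
than genesis uses an eligible coin of the slots `[t - w, t + ℓ)`; two coin counts are compared.

All this is deterministic given the coins, so only coin events need bounding. Chernoff and union
bounds make them negligible, uniformly in the adversary and in `t`. -/

theorem IsAncStar.mono {V W : Finset (Block n)} (h : V ⊆ W) {a b : Block n}
    (hab : E.IsAncStar V a b) : E.IsAncStar W a b :=
  Relation.ReflTransGen.mono (fun _ _ hxy => ⟨h hxy.1, h hxy.2.1, hxy.2.2⟩) _ _ hab

namespace Valid

variable {w : ℕ} {honest : Finset (Fin n)} {elig : ℕ × Fin n → Bool}

theorem view_eq (hE : E.Valid w honest elig) {P Q : Fin n} (hP : P ∈ honest) (hQ : Q ∈ honest)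
    (t : ℕ) : E.view P t = E.view Q t :=
  (hE.sync P hP Q hQ t).antisymm (hE.sync Q hQ P hP t)

theorem monotone_view (hE : E.Valid w honest elig) {P : Fin n} (hP : P ∈ honest) :
    Monotone (E.view P) :=
  monotone_nat_of_le_succ (hE.view_mono P hP)

theorem slot_le (hE : E.Valid w honest elig) {P : Fin n} (hP : P ∈ honest) {t : ℕ} {b : Block n}
    (hb : b ∈ E.view P t) : b.slot ≤ t := by
  cases b with
  | genesis => exact Nat.zero_le t
  | mk s v => exact (hE.eligible P hP t s v hb).2.1

theorem tips_eq (hE : E.Valid w honest elig) {P Q : Fin n} (hP : P ∈ honest) (hQ : Q ∈ honest)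
    (t : ℕ) : E.tips w P t = E.tips w Q t := by
  simp only [tips, window, hE.view_eq hP hQ t]

theorem frontier_eq_tips (hE : E.Valid w honest elig) (P : Fin n) (t : ℕ) :
    E.frontier w P t = E.tips w P t :=
  Set.ext fun _ => ⟨fun h => h.1, fun h => ⟨h, fun ⟨_, _, hc, _⟩ => hE.noConflict _ _ hc⟩⟩

theorem past_eq (hE : E.Valid w honest elig) {P Q : Fin n} (hP : P ∈ honest) (hQ : Q ∈ honest)
    (t : ℕ) : E.past w P t = E.past w Q t := by
  simp only [past, hE.frontier_eq_tips, hE.tips_eq hP hQ t, hE.view_eq hP hQ t]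

/-- Every block of the window is a tip or an ancestor of a tip. -/
theorem window_subset_past (hE : E.Valid w honest elig) {P : Fin n} (hP : P ∈ honest) (t : ℕ) :
    E.window w P t ⊆ E.past w P t := by
  suffices H : ∀ k (b : Block n), t - b.slot = k → b ∈ E.window w P t → b ∈ E.past w P t from
    fun b hb => H _ b rfl hb
  -- Induction on the age of the block: a block that short-references it is strictly younger and
  -- again in the window.
  intro k
  induction k using Nat.strong_induction_on with
  | _ k ih =>
    intro b hk hb
    by_cases hd : ∃ d ∈ E.window w P t, b ∈ E.shortRefs w d
    · obtain ⟨d, hdw, hbd⟩ := hd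
      simp only [shortRefs, Finset.mem_filter] at hbd
      have hdt := hE.slot_le hP hdw.1
      obtain ⟨x, hx, hdx⟩ := ih (t - d.slot) (by omega) d rfl hdw
      exact ⟨x, hx, Relation.ReflTransGen.head ⟨hb.1, hdw.1, hbd.1⟩ hdx⟩
    · refine ⟨b, ?_, Relation.ReflTransGen.refl⟩
      rw [hE.frontier_eq_tips]
      exact ⟨hb, hd⟩

theorem honest_mem_view (hE : E.Valid w honest elig) {P v : Fin n} (hP : P ∈ honest)
    (hv : v ∈ honest) {s t : ℕ} (hs : 1 ≤ s) (hst : s ≤ t) (hel : elig (s, v) = true) :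
    Block.mk s v ∈ E.view P t := by
  obtain ⟨s, rfl⟩ := Nat.exists_eq_add_of_le' hs
  exact hE.monotone_view hP hst (hE.sync v hv P hP _ (hE.honest_creates v hv s hel))

/-- An honest block has the whole past of the preceding slot among its ancestors. -/
theorem isAncStar_honest (hE : E.Valid w honest elig) {P v : Fin n} (hP : P ∈ honest)
    (hv : v ∈ honest) {s : ℕ} (hel : elig (s + 1, v) = true) {b : Block n}
    (hb : b ∈ E.past w P s) : E.IsAncStar (E.view P (s + 1)) b (Block.mk (s + 1) v) := by
  obtain ⟨x, hx, hbx⟩ := hb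
  rw [hE.frontier_eq_tips] at hx
  have hsub := hE.view_mono P hP s
  refine (hbx.mono hsub).tail ⟨hsub hx.1.1, hE.honest_mem_view hP hv (by omega) le_rfl hel, ?_⟩
  rw [hE.tips_eq hP hv] at hx
  exact (hE.honest_refs v hv s hel).1 hx

theorem mem_past_of_isAncStar (hE : E.Valid w honest elig) {P : Fin n} (hP : P ∈ honest)
    {s t : ℕ} (hst : s ≤ t) {b d : Block n} (hbd : E.IsAncStar (E.view P s) b d)
    (hd : d ∈ E.window w P t) : b ∈ E.past w P t := by
  obtain ⟨x, hx, hdx⟩ := hE.window_subset_past hP t hd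
  exact ⟨x, hx, (hbd.mono (hE.monotone_view hP hst)).trans hdx⟩

/-- An honest block of slot `s + 1` that is still in the window at the end of slot `t` keeps the
past of slot `s` in the past of slot `t`. -/
theorem past_subset_past (hE : E.Valid w honest elig) {P v : Fin n} (hP : P ∈ honest)
    (hv : v ∈ honest) {s t : ℕ} (hel : elig (s + 1, v) = true) (hst : s + 1 ≤ t)
    (htw : t ≤ s + 1 + w) : E.past w P s ⊆ E.past w P t := fun _ hb =>
  hE.mem_past_of_isAncStar hP hst (hE.isAncStar_honest hP hv hel hb)
    ⟨hE.honest_mem_view hP hv (by omega) hst hel, htw⟩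

/-- If every stretch of `w` slots after a block has an honest block, then the block stays in the
past. -/
theorem mem_past_of_dense (hE : E.Valid w honest elig) {P : Fin n} (hP : P ∈ honest)
    {b : Block n} (hb : b ∈ E.view P b.slot) (e : ℕ) (hbe : b.slot ≤ e)
    (hdense : ∀ r, b.slot < r → r + w ≤ e + 1 →
      ∃ s v, v ∈ honest ∧ r ≤ s ∧ s < r + w ∧ elig (s, v) = true) :
    b ∈ E.past w P e := by
  induction e using Nat.strong_induction_on with
  | _ e ih =>
    rcases Nat.lt_or_ge (b.slot + w) e with h | h
    -- Once `b` has left the window, use an honest block among the last `w` slots: it preserves the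
    -- past of the slot before it, where induction applies.
    · obtain ⟨s, v, hv, hrs, hsr, hel⟩ := hdense (e - w + 1) (by omega) (by omega)
      obtain ⟨s, rfl⟩ := Nat.exists_eq_add_of_le' (show 1 ≤ s by omega)
      refine hE.past_subset_past hP hv hel (by omega) (by omega) (ih s (by omega) (by omega) ?_)
      exact fun r hr hre => hdense r hr (by omega)
    · exact hE.window_subset_past hP e ⟨hE.monotone_view hP hbe hb, h⟩

/-- The untrimmed past already grows across each slot that has an honest block, so the depth `k` is
arbitrary. -/
theorem trimmedPast_subset (hE : E.Valid w honest elig) (k : ℕ) {P Q : Fin n} (hP : P ∈ honest)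
    (hQ : Q ∈ honest) {t₁ t₂ : ℕ} (h : t₁ ≤ t₂)
    (hdense : ∀ s, t₁ < s → s ≤ t₂ → ∃ v ∈ honest, elig (s, v) = true) :
    E.trimmedPast w k P t₁ ⊆ E.trimmedPast w k Q t₂ := by
  rintro b ⟨hb, hbk⟩
  refine ⟨?_, by omega⟩
  rw [hE.past_eq hP hQ] at hb
  induction t₂, h using Nat.le_induction with
  | base => exact hb
  | succ t h ih =>
    obtain ⟨v, hv, hel⟩ := hdense (t + 1) (by omega) le_rfl
    exact hE.past_subset_past hQ hv hel le_rfl (by omega)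
      (ih fun s h₁ h₂ => hdense s h₁ (by omega))

/-- Honest blocks enter the frontier in the slot of their creation. -/
theorem honest_mem_entering (hE : E.Valid w honest elig) {P v : Fin n} (hP : P ∈ honest)
    (hv : v ∈ honest) {s t ℓ : ℕ} (ht : 1 ≤ t) (hts : t ≤ s) (hst : s < t + ℓ)
    (hel : elig (s, v) = true) : Block.mk s v ∈ E.entering w P t ℓ := by
  refine ⟨s, hts, hst, ?_, fun hmem => ?_⟩
  · rw [hE.frontier_eq_tips]
    refine ⟨⟨hE.honest_mem_view hP hv (by omega) le_rfl hel, by simp [Block.slot]⟩, ?_⟩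
    -- A referencing block would need a slot beyond `s`, which no view at the end of slot `s`
    -- contains.
    rintro ⟨d, hd, hbd⟩
    have h₁ := hE.slot_le hP hd.1
    have h₂ : s + 1 ≤ d.slot := (Finset.mem_filter.1 hbd).2.1
    omega
  · have := hE.slot_le hP hmem.1.1.1
    simp only [Block.slot] at this
    omega

/-- The blocks entering the frontier during `t, …, t + ℓ - 1` are genesis or have slots in
`[t - w, t + ℓ)`. -/
theorem entering_subset (hE : E.Valid w honest elig) {P : Fin n} (hP : P ∈ honest) (t ℓ : ℕ) :
    E.entering w P t ℓ ⊆ insert Block.genesis ((fun i : ℕ × Fin n => Block.mk i.1 i.2) ''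
      {i | i ∈ Finset.Ico (t - w) (t + ℓ) ×ˢ Finset.univ ∧ elig i = true}) := by
  rintro b ⟨s, hts, hst, hb, -⟩
  cases b with
  | genesis => exact Set.mem_insert _ _
  | mk r v =>
    have hw := hb.1.1
    have h := hE.eligible P hP s r v hw.1
    have h₂ : s ≤ r + w := hw.2
    refine Set.mem_insert_of_mem _ ⟨(r, v), ⟨?_, h.2.2⟩, rfl⟩
    simp only [Finset.mem_product, Finset.mem_Ico, Finset.mem_univ, and_true]
    omega

end Valid

end Execution

theorem Block.mk_injective {n : ℕ} :
    Function.Injective fun i : ℕ × Fin n => Block.mk i.1 i.2 := by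
  rintro ⟨a, b⟩ ⟨c, d⟩ h
  simpa using h

/-! ### Tail bounds for the coins -/

/-- The number of coins of `S` that show `true`. -/
def coinCount {ι : Type*} (S : Finset ι) (x : ι → Bool) : ℕ :=
  (S.filter fun i => x i = true).card

namespace PublicCoin

variable {Ω : Type u} [MeasurableSpace Ω] {Pr : Measure Ω} {n : ℕ}
  {p : ℝ} {coin : ℕ × Fin n → Ω → Bool}

theorem measurable_coinCount (hc : PublicCoin Pr p coin) (S : Finset (ℕ × Fin n)) :
    Measurable fun ω => (coinCount S (fun i => coin i ω) : ℝ) := by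
  simp only [coinCount, Finset.card_filter, Nat.cast_sum]
  refine Finset.measurable_sum _ fun i _ => ?_
  simp only [Nat.cast_ite, Nat.cast_one, Nat.cast_zero]
  exact Measurable.ite (hc.measurable i (measurableSet_singleton true)) measurable_const
    measurable_const

variable [IsProbabilityMeasure Pr]

theorem mgf_coin (hc : PublicCoin Pr p coin) (hp : 0 ≤ p) (i : ℕ × Fin n) (c : ℝ) :
    mgf (fun ω => if coin i ω = true then (1 : ℝ) else 0) Pr c = 1 + p * (Real.exp c - 1) := by
  have hS : MeasurableSet {ω | coin i ω = true} := hc.measurable i (measurableSet_singleton true)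
  have hfun : (fun ω => Real.exp (c * if coin i ω = true then (1 : ℝ) else 0)) =
      fun ω => 1 + {ω | coin i ω = true}.indicator (fun _ => Real.exp c - 1) ω := by
    funext ω
    by_cases h : coin i ω = true <;> simp [h]
  rw [mgf, hfun, integral_add (integrable_const _) ((integrable_const _).indicator hS),
    integral_indicator_const _ hS, measureReal_def, hc.prob i, ENNReal.toReal_ofReal hp]
  simp

/-- Independence factors the moment generating function, and `1 + x ≤ exp x` bounds each factor by
its Poisson counterpart. -/
theorem mgf_coinCount_le (hc : PublicCoin Pr p coin) (hp : 0 ≤ p) (hp1 : p ≤ 1)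
    (S : Finset (ℕ × Fin n)) (c : ℝ) :
    mgf (fun ω => (coinCount S (fun i => coin i ω) : ℝ)) Pr c ≤
      Real.exp (p * S.card * (Real.exp c - 1)) := by
  have hind : iIndepFun (fun i ω => if coin i ω = true then (1 : ℝ) else 0) Pr :=
    hc.indep.comp (fun _ b => if b = true then (1 : ℝ) else 0) fun _ => measurable_of_finite _
  have hmeas : ∀ i, Measurable fun ω => if coin i ω = true then (1 : ℝ) else 0 := fun i =>
    Measurable.ite (hc.measurable i (measurableSet_singleton true)) measurable_const
      measurable_const
  have hsum : (fun ω => (coinCount S (fun i => coin i ω) : ℝ)) =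
      ∑ i ∈ S, fun ω => if coin i ω = true then (1 : ℝ) else 0 := by
    funext ω
    simp [coinCount]
  rw [hsum, hind.mgf_sum hmeas, Finset.prod_congr rfl fun i _ => hc.mgf_coin hp i c,
    Finset.prod_const]
  have h0 : 0 ≤ 1 + p * (Real.exp c - 1) := by nlinarith [Real.exp_pos c]
  calc (1 + p * (Real.exp c - 1)) ^ S.card ≤ Real.exp (p * (Real.exp c - 1)) ^ S.card := by
        gcongr
        linarith [Real.add_one_le_exp (p * (Real.exp c - 1))]
    _ = _ := by rw [← Real.exp_nat_mul]; ring_nf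

theorem integrable_exp_coinCount (hc : PublicCoin Pr p coin) (S : Finset (ℕ × Fin n)) (c : ℝ) :
    Integrable (fun ω => Real.exp (c * (coinCount S (fun i => coin i ω) : ℝ))) Pr := by
  refine Integrable.of_bound (C := Real.exp (|c| * S.card))
    ((hc.measurable_coinCount S).const_mul c).exp.aestronglyMeasurable (ae_of_all _ fun ω => ?_)
  rw [Real.norm_eq_abs, Real.abs_exp, Real.exp_le_exp]
  have : (coinCount S (fun i => coin i ω) : ℝ) ≤ S.card := by
    exact_mod_cast Finset.card_filter_le _ _
  exact mul_le_mul (le_abs_self c) this (Nat.cast_nonneg _) (abs_nonneg c)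

/-- Lower Chernoff bound. -/
theorem measure_coinCount_le (hc : PublicCoin Pr p coin) (hp : 0 ≤ p) (hp1 : p ≤ 1)
    (S : Finset (ℕ × Fin n)) :
    Pr {ω | (coinCount S (fun i => coin i ω) : ℝ) ≤ p * S.card / 2} ≤
      ENNReal.ofReal (Real.exp (-(p * S.card / 8))) := by
  rw [← ofReal_measureReal]
  refine ENNReal.ofReal_le_ofReal ((measure_le_le_exp_mul_mgf (t := -1) _ (by norm_num)
    (hc.integrable_exp_coinCount S _)).trans ?_)
  refine (mul_le_mul_of_nonneg_left (hc.mgf_coinCount_le hp hp1 S _) (Real.exp_nonneg _)).trans ?_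
  rw [← Real.exp_add, Real.exp_le_exp]
  have : 0 ≤ p * S.card := by positivity
  -- The exponent per unit of mean is `1/2 + (e⁻¹ - 1) < -1/8`.
  nlinarith [Real.exp_neg_one_lt_d9]

/-- Upper Chernoff bound. -/
theorem measure_le_coinCount (hc : PublicCoin Pr p coin) (hp : 0 ≤ p) (hp1 : p ≤ 1)
    (S : Finset (ℕ × Fin n)) {M : ℝ} (hM : p * S.card ≤ M) :
    Pr {ω | 2 * M ≤ (coinCount S (fun i => coin i ω) : ℝ)} ≤
      ENNReal.ofReal (Real.exp (-(M / 4))) := by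
  rw [← ofReal_measureReal]
  refine ENNReal.ofReal_le_ofReal ((measure_ge_le_exp_mul_mgf (t := 1) _ (by norm_num)
    (hc.integrable_exp_coinCount S _)).trans ?_)
  refine (mul_le_mul_of_nonneg_left (hc.mgf_coinCount_le hp hp1 S _) (Real.exp_nonneg _)).trans ?_
  rw [← Real.exp_add, Real.exp_le_exp]
  have : 0 ≤ p * S.card := by positivity
  -- As `e - 1 ≥ 0`, the mean may be replaced by `M`; then `-2 + (e - 1) < -1/4`.
  nlinarith [Real.exp_one_lt_d9, Real.add_one_le_exp (1 : ℝ)]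

/-- Union bound: it is unlikely that one of the stretches of `m` slots that start in `R` has no
eligible validator of `A`. -/
theorem measure_exists_gap_le (hc : PublicCoin Pr p coin) (hp : 0 ≤ p) (hp1 : p ≤ 1)
    (A : Finset (Fin n)) (R : Finset ℕ) (m : ℕ) :
    Pr {ω | ∃ r ∈ R, ∀ s v, v ∈ A → r ≤ s → s < r + m → coin (s, v) ω ≠ true} ≤
      ENNReal.ofReal (R.card * Real.exp (-(1 / 8 * (m * (p * A.card))))) := by
  have hsub : {ω | ∃ r ∈ R, ∀ s v, v ∈ A → r ≤ s → s < r + m → coin (s, v) ω ≠ true} ⊆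
      ⋃ r ∈ R, {ω | (coinCount (Finset.Ico r (r + m) ×ˢ A) (fun i => coin i ω) : ℝ) ≤
        p * (Finset.Ico r (r + m) ×ˢ A).card / 2} := by
    rintro ω ⟨r, hr, h⟩
    refine Set.mem_biUnion hr ?_
    -- An empty stretch has count zero, at most half the mean, so the lower Chernoff bound covers
    -- it.
    have h0 : coinCount (Finset.Ico r (r + m) ×ˢ A) (fun i => coin i ω) = 0 := by
      rw [coinCount, Finset.card_eq_zero, Finset.filter_eq_empty_iff]
      rintro ⟨s, v⟩ hi
      simp only [Finset.mem_product, Finset.mem_Ico] at hi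
      exact h s v hi.2 hi.1.1 hi.1.2
    simp only [Set.mem_ofPred_eq, h0, Nat.cast_zero]
    positivity
  refine (measure_mono hsub).trans ((measure_biUnion_finset_le _ _).trans
    ((Finset.sum_le_sum fun r _ => hc.measure_coinCount_le hp hp1 _).trans ?_))
  simp only [Finset.card_product, Nat.card_Ico, add_tsub_cancel_left, Finset.sum_const,
    nsmul_eq_mul]
  rw [ENNReal.ofReal_mul (Nat.cast_nonneg _), ENNReal.ofReal_natCast]
  gcongr
  push_cast
  linarith

end PublicCoin

/-! ### Negligible functions -/

/-- For each exponent `z`, eventually `(|z| + 1) log κ ≤ c f κ`, hence `exp (-c f κ) ≤ κ ^ z`. -/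
theorem SuperLog.negligible_exp {f : ℕ → ℝ} (hf : SuperLog f) (hf0 : ∀ κ, 0 ≤ f κ) {c : ℝ}
    (hc : 0 < c) : Negligible fun κ => Real.exp (-(c * f κ)) := by
  refine (superpolynomialDecay_iff_isBigO _ tendsto_natCast_atTop_atTop).2 fun z => ?_
  have hpos : 0 < |(z : ℝ)| + 1 := by positivity
  refine IsBigO.of_bound 1 ?_
  filter_upwards [hf.bound (div_pos hc hpos), eventually_ge_atTop 1] with κ hκ h1
  have hκ0 : (0 : ℝ) < κ := by exact_mod_cast h1
  have hlog : 0 ≤ Real.log κ := Real.log_nonneg (by exact_mod_cast h1)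
  rw [Real.norm_of_nonneg hlog, Real.norm_of_nonneg (hf0 κ), div_mul_eq_mul_div,
    le_div_iff₀ hpos] at hκ
  rw [one_mul, Real.norm_of_nonneg (Real.exp_nonneg _), Real.norm_of_nonneg (by positivity),
    ← Real.rpow_intCast, Real.rpow_def_of_pos hκ0, Real.exp_le_exp]
  nlinarith [neg_abs_le (z : ℝ)]

theorem Negligible.polyBounded_mul {ε : ℕ → ℝ} (hε : Negligible ε) {g : ℕ → ℕ}
    (hg : PolyBounded g) : Negligible fun κ => g κ * ε κ := by
  obtain ⟨d, hd⟩ := hg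
  refine (superpolynomialDecay_iff_isBigO _ tendsto_natCast_atTop_atTop).2 fun z => ?_
  have h := (superpolynomialDecay_iff_isBigO _ tendsto_natCast_atTop_atTop).1 hε (z - d)
  refine (hd.mul h).congr' EventuallyEq.rfl ?_
  filter_upwards [eventually_ge_atTop 1] with κ h1
  have hκ0 : (κ : ℝ) ≠ 0 := by positivity
  rw [← zpow_natCast, ← zpow_add₀ hκ0]
  congr 1
  ring

/-- Needed for quality, where it absorbs the one extra block, genesis. -/
theorem SuperLog.eventually_one_le {f : ℕ → ℝ} (hf : SuperLog f) (hf0 : ∀ κ, 0 ≤ f κ) :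
    ∀ᶠ κ in atTop, 1 ≤ f κ := by
  have hlog : ∀ᶠ κ : ℕ in atTop, 1 ≤ Real.log κ :=
    (Real.tendsto_log_atTop.comp tendsto_natCast_atTop_atTop).eventually_ge_atTop 1
  filter_upwards [hf.bound one_pos, hlog] with κ hκ h1
  rw [Real.norm_of_nonneg (zero_le_one.trans h1), Real.norm_of_nonneg (hf0 κ), one_mul] at hκ
  exact h1.trans hκ

/-! ### Counting blocks -/

namespace Execution.Valid

variable {n : ℕ} {E : Execution n} {w : ℕ} {honest : Finset (Fin n)} {elig : ℕ × Fin n → Bool}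

/-- Distinct coins give distinct blocks. Finiteness matters because `ncard` is `0` on infinite sets.
-/
theorem coinCount_le_ncard {A : Finset (ℕ × Fin n)} {B : Set (Block n)} (hB : B.Finite)
    (h : ∀ s v, (s, v) ∈ A → elig (s, v) = true → Block.mk s v ∈ B) :
    coinCount A elig ≤ B.ncard := by
  rw [coinCount, ← Set.ncard_coe_finset, ← Set.ncard_image_of_injective _ Block.mk_injective]
  refine Set.ncard_le_ncard ?_ hB
  rintro _ ⟨⟨s, v⟩, hi, rfl⟩
  have hi := Finset.mem_filter.1 (Finset.mem_coe.1 hi)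
  exact h s v hi.1 hi.2

theorem finite_grown (E : Execution n) (w : ℕ) (honest : Finset (Fin n)) (t ℓ : ℕ) :
    (E.grown w honest t ℓ).Finite := by
  refine ((Finset.finite_toSet (Finset.Ico t (t + ℓ) ×ˢ (Finset.univ : Finset (Fin n)))).image
    fun i : ℕ × Fin n => Block.mk i.1 i.2).subset ?_
  rintro (_ | ⟨s, v⟩) ⟨hh, h₁, h₂, -⟩
  · exact hh.elim
  · refine ⟨(s, v), ?_, rfl⟩
    simpa using (⟨h₁, h₂⟩ : t ≤ s ∧ s < t + ℓ)

theorem coinCount_le_ncard_grown (hE : E.Valid w honest elig) (hne : honest.Nonempty)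
    (hw : 1 ≤ w) {t ℓ : ℕ} (ht : 1 ≤ t)
    (hdense : ∀ r ∈ Finset.Ico t (t + ℓ),
      ∃ s v, v ∈ honest ∧ r ≤ s ∧ s < r + w ∧ elig (s, v) = true) :
    coinCount (Finset.Ico t (t + ℓ) ×ˢ honest) elig ≤ (E.grown w honest t ℓ).ncard := by
  refine coinCount_le_ncard (finite_grown E w honest t ℓ) fun s v hi hel => ?_
  obtain ⟨P, hP⟩ := hne
  simp only [Finset.mem_product, Finset.mem_Ico] at hi
  refine ⟨hi.2, hi.1.1, hi.1.2, P, hP, hE.mem_past_of_dense hP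
    (hE.honest_mem_view hP hi.2 (ht.trans hi.1.1) le_rfl hel) _ ?_ fun r hr hre => ?_⟩
  · simp only [Block.slot]
    omega
  · simp only [Block.slot] at hr
    exact hdense r (Finset.mem_Ico.2 (by omega))

theorem finite_entering (hE : E.Valid w honest elig) {P : Fin n} (hP : P ∈ honest) (t ℓ : ℕ) :
    (E.entering w P t ℓ).Finite := by
  refine (((Finset.finite_toSet (Finset.Ico (t - w) (t + ℓ) ×ˢ Finset.univ)).subset
    fun i hi => ?_).image _ |>.insert _).subset (hE.entering_subset hP t ℓ)
  exact Finset.mem_coe.2 hi.1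

/-- The coins bound corrupted blocks too, since these also need eligibility; the `+ 1` is genesis.
-/
theorem ncard_entering_le (hE : E.Valid w honest elig) {P : Fin n} (hP : P ∈ honest) (t ℓ : ℕ) :
    (E.entering w P t ℓ).ncard ≤
      coinCount (Finset.Ico (t - w) (t + ℓ) ×ˢ Finset.univ) elig + 1 := by
  have hset : {i | i ∈ Finset.Ico (t - w) (t + ℓ) ×ˢ Finset.univ ∧ elig i = true} =
      (((Finset.Ico (t - w) (t + ℓ) ×ˢ Finset.univ).filter fun i => elig i = true :
        Finset (ℕ × Fin n)) : Set (ℕ × Fin n)) := by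
    ext i
    simp
  have hsub := hE.entering_subset hP t ℓ
  rw [hset] at hsub
  refine (Set.ncard_le_ncard hsub (((Finset.finite_toSet _).image _).insert _)).trans
    ((Set.ncard_insert_le _ _).trans ?_)
  rw [Set.ncard_image_of_injective _ Block.mk_injective, Set.ncard_coe_finset, coinCount]

theorem coinCount_le_ncard_entering (hE : E.Valid w honest elig) {P : Fin n} (hP : P ∈ honest)
    {t : ℕ} (ht : 1 ≤ t) (ℓ : ℕ) :
    coinCount (Finset.Ico t (t + ℓ) ×ˢ honest) elig ≤
      {b ∈ E.entering w P t ℓ | b.IsHonest honest}.ncard := by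
  refine coinCount_le_ncard ((hE.finite_entering hP t ℓ).subset fun _ h => h.1)
    fun s v hi hel => ?_
  simp only [Finset.mem_product, Finset.mem_Ico] at hi
  exact ⟨hE.honest_mem_entering hP hi.2 ht hi.1.1 hi.1.2 hel, hi.2⟩

end Execution.Valid

/-! ### The consensus properties -/

namespace Params

variable (par : Params)

theorem honest_nonempty : par.honest.Nonempty := by
  rw [Finset.nonempty_iff_ne_empty]
  intro h
  have := par.honest_majority
  rw [h] at this
  norm_num at this

theorem n_pos : 0 < par.n :=
  Fin.pos_iff_nonempty.2 ⟨par.honest_nonempty.choose⟩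

theorem H_mul_n : par.H * par.n = par.honest.card :=
  div_mul_cancel₀ _ (Nat.cast_ne_zero.2 par.n_pos.ne')

theorem honest_card_le : (par.honest.card : ℝ) ≤ par.n := by
  exact_mod_cast (Finset.card_le_univ par.honest).trans_eq (Fintype.card_fin _)

theorem H_nonneg : 0 ≤ par.H := by
  rw [H]
  positivity

theorem H_le_one : par.H ≤ 1 :=
  div_le_one_of_le₀ par.honest_card_le (Nat.cast_nonneg _)

theorem H_le_card : par.H ≤ par.honest.card :=
  par.H_le_one.trans (by exact_mod_cast par.honest_nonempty.card_pos)

theorem honestRate_nonneg : 0 ≤ par.honestRate :=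
  mul_nonneg par.p_pos.le (Nat.cast_nonneg _)

end Params

theorem dagGrowth (par : ℕ → Params) (ℓ : ℕ → ℕ)
    (hw : SuperLog fun κ => (par κ).w * (par κ).honestRate)
    (hℓ : SuperLog fun κ => ℓ κ * (par κ).honestRate) (hpoly : PolyBounded ℓ) :
    DAGGrowth.{u} par (fun κ => (par κ).p * (par κ).H / 2) ℓ := by
  have hrate := fun κ => (par κ).honestRate_nonneg
  have hnegw := (hw.negligible_exp (fun κ => mul_nonneg (Nat.cast_nonneg _) (hrate κ))
    (c := 1 / 8) (by norm_num)).polyBounded_mul hpoly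
  have hnegℓ := hℓ.negligible_exp (fun κ => mul_nonneg (Nat.cast_nonneg _) (hrate κ))
    (c := 1 / 8) (by norm_num)
  -- Two failures: one of the `ℓ` stretches of length `w` has no honest block, or there are too few
  -- honest blocks overall.
  refine ⟨_, hnegw.add hnegℓ, fun κ t Ω _ Pr _ coin E hc hE => ?_⟩
  have hp := (par κ).p_pos.le
  have hgap := hc.measure_exists_gap_le hp (par κ).p_le_one (par κ).honest
    (Finset.Ico t (t + ℓ κ)) (par κ).w
  have hcount := hc.measure_coinCount_le hp (par κ).p_le_one
    (Finset.Ico t (t + ℓ κ) ×ˢ (par κ).honest)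
  simp only [Nat.card_Ico, add_tsub_cancel_left, Finset.card_product] at hgap hcount
  rw [Pi.add_apply, ENNReal.ofReal_add (by positivity) (by positivity)]
  refine (measure_mono ?_).trans ((measure_union_le _ _).trans (add_le_add hgap (hcount.trans ?_)))
  · intro ω hω
    by_contra hcon
    simp only [Set.mem_union, Set.mem_ofPred_eq, not_or, not_exists, not_and, not_forall,
      not_not, not_le] at hcon
    refine hω fun ht => ?_
    have hle := (hE ω).coinCount_le_ncard_grown (par κ).honest_nonempty (par κ).w_pos
      (ℓ := ℓ κ) ht
      fun r hr => by
        obtain ⟨s, v, h₁, h₂, h₃, h₄⟩ := hcon.1 r hr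
        exact ⟨s, v, h₁, h₂, h₃, h₄⟩
    refine le_trans ?_ (Nat.cast_le.2 hle)
    refine le_trans ?_ hcon.2.le
    -- The count is at least half of `p * honest.card * ℓ`; `H ≤ 1 ≤ honest.card` weakens this to
    -- the rate `p * H / 2`.
    have := mul_le_mul_of_nonneg_left (par κ).H_le_card
      (mul_nonneg hp (Nat.cast_nonneg (ℓ κ)))
    push_cast
    linarith
  · refine ENNReal.ofReal_le_ofReal (Real.exp_le_exp.2 (le_of_eq ?_))
    simp only [Params.honestRate]
    push_cast
    ring

theorem dagCommonPast (par : ℕ → Params) (k : ℕ) (T : ℕ → ℕ)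
    (hrate : SuperLog fun κ => (par κ).honestRate) (hpoly : PolyBounded T) :
    DAGCommonPast.{u} par k T := by
  refine ⟨_, (hrate.negligible_exp (fun κ => (par κ).honestRate_nonneg)
    (c := 1 / 8) (by norm_num)).polyBounded_mul hpoly, fun κ t Ω _ Pr _ coin E hc hE => ?_⟩
  -- Stretches of length `1`: each of the `T` slots after `t` must have an honest block.
  have hgap := hc.measure_exists_gap_le (par κ).p_pos.le (par κ).p_le_one (par κ).honest
    (Finset.Ioc t (t + T κ)) 1
  simp only [Nat.card_Ioc, add_tsub_cancel_left, Nat.cast_one, one_mul] at hgap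
  refine (measure_mono ?_).trans hgap
  intro ω hω
  by_contra hcon
  simp only [Set.mem_ofPred_eq, not_exists, not_and, not_forall, not_not] at hcon
  refine hω fun P hP Q hQ t₁ t₂ h₁ h₁₂ h₂ => ?_
  refine (hE ω).trimmedPast_subset k hP hQ h₁₂ fun s hs₁ hs₂ => ?_
  obtain ⟨s', v, hv, hss', hs's, hel⟩ := hcon s (Finset.mem_Ioc.2 (by omega))
  obtain rfl : s' = s := by omega
  exact ⟨v, hv, hel⟩

theorem dagQuality (C : ℝ) (par : ℕ → Params) (ℓ : ℕ → ℕ)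
    (hℓ : SuperLog fun κ => ℓ κ * (par κ).honestRate)
    (hw : ∀ᶠ κ in atTop, ((par κ).w : ℝ) ≤ C * ℓ κ) :
    DAGQuality.{u} par (fun κ => (par κ).H / (8 * (1 + |C|))) ℓ := by
  classical
  have hf0 : ∀ κ, 0 ≤ ℓ κ * (par κ).honestRate := fun κ =>
    mul_nonneg (Nat.cast_nonneg _) (par κ).honestRate_nonneg
  have hneg := hℓ.negligible_exp hf0 (c := 1 / 8) (by norm_num)
  -- The two conditions hold only eventually; for the other `κ` the trivial bound `1` serves and
  -- does not affect negligibility.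
  refine ⟨fun κ => if ((par κ).w : ℝ) ≤ C * ℓ κ ∧ 1 ≤ ℓ κ * (par κ).honestRate then
      Real.exp (-(1 / 8 * (ℓ κ * (par κ).honestRate))) +
        Real.exp (-(1 / 8 * (ℓ κ * (par κ).honestRate))) else 1,
    (hneg.add hneg).congr' ?_, fun κ t Ω _ Pr _ coin E hc hE => ?_⟩
  · filter_upwards [hw, hℓ.eventually_one_le hf0] with κ h₁ h₂
    rw [if_pos ⟨h₁, h₂⟩, Pi.add_apply]
  beta_reduce
  split_ifs with hκ
  swap
  · simpa using prob_le_one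
  obtain ⟨hwκ, hone⟩ := hκ
  have hp := (par κ).p_pos.le
  have hC : 0 < 1 + |C| := by positivity
  -- `M` bounds the mean number of eligible coins in `[t - w, t + ℓ)`, which has at most `ℓ + w ≤ (1
  -- + |C|) ℓ` slots.
  set M : ℝ := (par κ).p * (par κ).n * ((1 + |C|) * ℓ κ) with hM
  have hrate : ℓ κ * (par κ).honestRate ≤ (par κ).p * (par κ).n * ℓ κ := by
    have := mul_le_mul_of_nonneg_left (par κ).honest_card_le
      (mul_nonneg hp (Nat.cast_nonneg (ℓ κ)))
    simp only [Params.honestRate]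
    linarith
  have hrateM : ℓ κ * (par κ).honestRate ≤ M := by
    have : 0 ≤ (par κ).p * (par κ).n * (|C| * ℓ κ) := by positivity
    linarith
  have hcount := hc.measure_coinCount_le hp (par κ).p_le_one
    (Finset.Ico t (t + ℓ κ) ×ˢ (par κ).honest)
  have hcard : (par κ).p *
      ((Finset.Ico (t - (par κ).w) (t + ℓ κ) ×ˢ (Finset.univ : Finset (Fin (par κ).n))).card : ℝ) ≤
        M := by
    have h₁ : t + ℓ κ - (t - (par κ).w) ≤ ℓ κ + (par κ).w := by omega
    have h₂ : ((t + ℓ κ - (t - (par κ).w) : ℕ) : ℝ) ≤ (1 + |C|) * ℓ κ := by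
      have h₃ := mul_le_mul_of_nonneg_right (le_abs_self C) (Nat.cast_nonneg (α := ℝ) (ℓ κ))
      have h₄ : ((t + ℓ κ - (t - (par κ).w) : ℕ) : ℝ) ≤ ℓ κ + (par κ).w := by exact_mod_cast h₁
      linarith
    rw [Finset.card_product, Nat.card_Ico, Finset.card_univ, Fintype.card_fin, Nat.cast_mul, hM,
      mul_assoc, mul_comm (((par κ).n : ℝ))]
    gcongr
  have htotal := hc.measure_le_coinCount hp (par κ).p_le_one _ hcard
  rw [ENNReal.ofReal_add (by positivity) (by positivity)]
  simp only [Nat.card_Ico, add_tsub_cancel_left, Finset.card_product] at hcount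
  refine (measure_mono ?_).trans ((measure_union_le _ _).trans
    (add_le_add (hcount.trans (ENNReal.ofReal_le_ofReal (Real.exp_le_exp.2 (le_of_eq ?_))))
      (htotal.trans (ENNReal.ofReal_le_ofReal (Real.exp_le_exp.2 ?_)))))
  · intro ω hω
    by_contra hcon
    simp only [Set.mem_union, Set.mem_ofPred_eq, not_or, not_le] at hcon
    refine hω fun ht P hP => ?_
    have hlow : (_ : ℝ) ≤ _ :=
      Nat.cast_le.2 ((hE ω).coinCount_le_ncard_entering hP ht (ℓ κ))
    have hup : ((_ : ℕ) : ℝ) ≤ _ := Nat.cast_le.2 ((hE ω).ncard_entering_le hP t (ℓ κ))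
    push_cast at hup
    have hμ0 : 0 ≤ (par κ).H / (8 * (1 + |C|)) := div_nonneg (par κ).H_nonneg (by positivity)
    have hμ1 : (par κ).H / (8 * (1 + |C|)) ≤ 1 / 8 := by
      rw [div_le_div_iff₀ (by positivity) (by norm_num)]
      linarith [(par κ).H_le_one, abs_nonneg C]
    have hμM : (par κ).H / (8 * (1 + |C|)) * M = ℓ κ * (par κ).honestRate / 8 := by
      rw [hM, Params.honestRate, ← (par κ).H_mul_n]
      field_simp
    refine le_trans ?_ hlow
    refine le_trans (mul_le_mul_of_nonneg_left (hup.trans (add_le_add_left hcon.2.le 1)) hμ0) ?_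
    refine le_trans ?_ hcon.1.le
    have hrw : (par κ).p * ((ℓ κ * (par κ).honest.card : ℕ) : ℝ) / 2 =
        ℓ κ * (par κ).honestRate / 2 := by
      simp only [Params.honestRate]
      push_cast
      ring
    -- With `f = ℓ * honestRate ≥ 1`, the total is at most `2 M + 1` and `μ M = f / 8`, so `μ (2 M +
    -- 1) ≤ f / 4 + 1 / 8 ≤ f / 2`; the `8` in `μ` leaves this room.
    rw [hrw, mul_add, mul_left_comm, hμM]
    linarith
  · simp only [Params.honestRate]
    push_cast
    ring
  · linarith [hf0 κ]

end AreonIdeal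

open AreonIdeal in
theorem mainTheorem9 :
    -- DAG growth with `τ = Θ(pH)`
    (∃ (τ : ℝ → ℝ → ℝ) (c₁ c₂ : ℝ), 0 < c₁ ∧ 0 < c₂ ∧
      (∀ p H : ℝ, 0 < p → p ≤ 1 → 1 / 2 < H → H ≤ 1 →
        0 < τ p H ∧ τ p H ≤ 1 ∧ c₁ * (p * H) ≤ τ p H ∧ τ p H ≤ c₂ * (p * H)) ∧
      ∀ (par : ℕ → Params) (ℓ : ℕ → ℕ),
        SuperLog (fun κ => (par κ).w * (par κ).honestRate) →
        SuperLog (fun κ => ℓ κ * (par κ).honestRate) →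
        PolyBounded ℓ →
        DAGGrowth.{u} par (fun κ => τ (par κ).p (par κ).H) ℓ) ∧
    -- DAG quality with `μ = Θ(H)`
    (∀ C : ℝ, ∃ (μ : ℝ → ℝ) (c₁ c₂ : ℝ), 0 < c₁ ∧ 0 < c₂ ∧
      (∀ H : ℝ, 1 / 2 < H → H ≤ 1 →
        0 < μ H ∧ μ H ≤ 1 ∧ c₁ * H ≤ μ H ∧ μ H ≤ c₂ * H) ∧
      ∀ (par : ℕ → Params) (ℓ : ℕ → ℕ),
        SuperLog (fun κ => ℓ κ * (par κ).honestRate) →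
        (∀ᶠ κ in Filter.atTop, ((par κ).w : ℝ) ≤ C * ℓ κ) →
        DAGQuality.{u} par (fun κ => μ (par κ).H) ℓ) ∧
    -- DAG common past with `k = O(1)`
    (∃ k : ℕ, ∀ (par : ℕ → Params) (T : ℕ → ℕ),
      SuperLog (fun κ => (par κ).honestRate) →
      PolyBounded T →
      DAGCommonPast.{u} par k T) := by
  -- Both rates are exact multiples of `p * H` and `H`, so `c₁ = c₂`; the depth `1` is an arbitrary
  -- choice.
  refine ⟨⟨fun p H => p * H / 2, 1 / 2, 1 / 2, by norm_num, by norm_num,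
      fun p H hp hp1 hH hH1 => ?_, dagGrowth⟩, fun C => ?_, 1, fun par T => dagCommonPast par 1 T⟩
  · have h₁ : 0 < p * H := mul_pos hp (by linarith)
    have h₂ : p * H ≤ 1 := mul_le_one₀ hp1 (by linarith) hH1
    exact ⟨by linarith, by linarith, by linarith, by linarith⟩
  · have hC : 0 < 8 * (1 + |C|) := by positivity
    refine ⟨fun H => H / (8 * (1 + |C|)), 1 / (8 * (1 + |C|)), 1 / (8 * (1 + |C|)), by positivity,
      by positivity, fun H hH hH1 => ⟨div_pos (by linarith) hC, ?_, ?_, ?_⟩, dagQuality C⟩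
    · rw [div_le_one hC]
      linarith [abs_nonneg C]
    · exact (one_div_mul_eq_div _ _).le
    · exact (one_div_mul_eq_div _ _).ge
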